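/- Let $\Lambda$ be an Artin algebra and let $\mathrm{mod}\,\Lambda$ be the category of finitely generated left $\Lambda$-modules. For $\mathcal X\subseteq\mathrm{mod}\,\Lambda$ let $\mathrm{add}\,\mathcal X$ be the class of direct summands of finite direct sums of modules in $\mathcal X$. Let $\Omega M$ denote the syzygy of $M$, i.e. the kernel of a projective cover of $M$, and let $\mathrm{pd}$, $\mathrm{id}$ denote projective and injective dimension, with $\mathrm{pd}\,0=\mathrm{id}\,0=0$. For $T\in\mathrm{mod}\,\Lambda$ put ${}^{\perp}T=\{M\in\mathrm{mod}\,\Lambda:\mathrm{Ext}^i_\Lambda(M,T)=0\text{ for all }i\ge 1\}$. The module $T$ is *cotilting* if $\mathrm{id}\,T<\infty$, $\mathrm{Ext}^i_\Lambda(T,T)=0$ for all $i>0$, and every injective $I\in\mathrm{mod}\,\Lambda$ admits, for some $m\ge 0$, an exact sequence $0\to T_m\to\cdots\to T_0\to I\to 0$ with all $T_i\in\mathrm{add}\,T$. *Igusa–Todorov functions.* Let $K$ be the free abelian group on the isomorphism classes $[M]$, $M\in\mathrm{mod}\,\Lambda$, modulo the relations $[M]-[X]-[Y]$ whenever $M\cong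 X\oplus Y$, and let $\langle\mathcal P\rangle\subseteq K$ be the subgroup generated by the classes of indecomposable projective modules. The assignment $[M]\mapsto[\Omega M]$ induces an endomorphism $\overline L$ of $K_{\mathcal P}=K/\langle\mathcal P\rangle$. For $X\in\mathrm{mod}\,\Lambda$ let $\overline{\langle X\rangle}\subseteq K_{\mathcal P}$ be the subgroup generated by the classes of the indecomposable modules in $\mathrm{add}\,X$, and let $\Phi(X)\in\mathbb N$ be the least $k$ such that $\overline L:\overline L^{m}(\overline{\langle X\rangle})\to\overline L^{m+1}(\overline{\langle X\rangle})$ is an isomorphism for all $m\ge k$. For $\mathcal X\subseteq\mathrm{mod}\,\Lambda$ let $\mathrm{fin.dim}(\mathcal X)=\sup\{\mathrm{pd}\,X: X\in\mathcal X,\ \mathrm{pd}\,X<\infty\}$, and put $\Psi(X)=\Phi(X)+\mathrm{fin.dim}(\{Z: Z\text{ is a direct summand of }\Omega^{\Phi(X)}X\})$. Let $\Phi\mathrm{dim}(\mathcal X)=\sup_{X\in\mathcal X}\Phi(X)$ and $\Psi\mathrm{dim}(\mathcal X)=\sup_{X\in\mathcal X}\Psi(X)$; for $\mathcal X=\mathrm{mod}\,\Lambda$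 write $\mathrm{fin.dim}\,\Lambda$, $\Phi\mathrm{dim}\,\Lambda$, $\Psi\mathrm{dim}\,\Lambda$. *LIT-algebras.* Let $n\ge 0$, $V\in\mathrm{mod}\,\Lambda$ and $\mathcal D\subseteq\mathrm{mod}\,\Lambda$. The algebra $\Lambda$ is an $(n,V,\mathcal D)$-*LIT-algebra* (Lat-Igusa-Todorov algebra) if $\mathrm{add}\,\mathcal D=\mathcal D$, $\Omega\mathcal D\subseteq\mathcal D$, $\Phi\mathrm{dim}(\mathcal D)=0$, and for every $M\in\mathrm{mod}\,\Lambda$ there is an exact sequence $0\to V_1\oplus D_1\to V_0\oplus D_0\to\Omega^nM\to 0$ with $V_0,V_1\in\mathrm{add}\,V$ and $D_0,D_1\in\mathcal D$. **Proposition.** Let $\Lambda$ be an Artin algebra and let $T\in\mathrm{mod}\,\Lambda$ be a cotilting module with $\Phi\mathrm{dim}({}^{\perp}T)=0$ and $\mathrm{id}\,T\le 1$. Then $\Lambda$ is an $(n,0,{}^{\perp}T)$-LIT-algebra for every $n\ge 0$, and $$\mathrm{fin.dim}\,\Lambda\le\Phi\mathrm{dim}\,\Lambda\le\Psi\mathrm{dim}\,\Lambda\le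 1.$$ -/

import Mathlib

open CategoryTheory

universe u v

noncomputable section

/-- `Λ` is an Artin algebra: it is an algebra over some commutative artinian ring `R` and is
finitely generated as an `R`-module.  It loses nothing to take `R` in the universe of `Λ`, see
`IsArtinAlgebra.of_finite`. -/
class IsArtinAlgebra (Λ : Type u) [Ring Λ] : Prop where
  exists_base : ∃ (R : Type u) (_ : CommRing R) (_ : Algebra R Λ),
    IsArtinianRing R ∧ Module.Finite R Λ

theorem IsArtinAlgebra.of_finite (R : Type v) [CommRing R] [IsArtinianRing R]
    (Λ : Type u) [Ring Λ] [Algebra R Λ] [Module.Finite R Λ] : IsArtinAlgebra Λ := by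
  have : IsArtinian R Λ := isArtinian_of_fg_of_artinian'
  refine ⟨Subalgebra.center R Λ, inferInstance, Algebra.ofModule (fun r x y => by
    simp [Subalgebra.smul_def, mul_assoc]) (fun r x y => by
    have := Subalgebra.mem_center_iff.1 r.2 x
    simp only [Subalgebra.smul_def, smul_eq_mul]
    rw [← mul_assoc, this, mul_assoc]), ?_, ?_⟩
  · have : IsArtinian R (Subalgebra.center R Λ) :=
      isArtinian_submodule' (Subalgebra.toSubmodule (Subalgebra.center R Λ))
    exact isArtinian_of_tower R this
  · exact Module.Finite.of_restrictScalars_finite R (Subalgebra.center R Λ) Λ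

instance IsArtinAlgebra.isArtinianRing (Λ : Type u) [Ring Λ] [h : IsArtinAlgebra Λ] :
    IsArtinianRing Λ := by
  obtain ⟨R, _, _, _, _⟩ := h.exists_base
  have : IsArtinian R Λ := isArtinian_of_fg_of_artinian'
  exact isArtinian_of_tower R this

namespace LIT

/-! ### Additive closure, summands, indecomposables

The category `mod Λ` is `FGModuleCat Λ`, and a class of objects of `mod Λ` is a
`Set (FGModuleCat Λ)`. -/

section Classes

variable {Λ : Type u} [Ring Λ]

/-- The class of finitely generated projective modules. -/
def projectives (Λ : Type u) [Ring Λ] : Set (FGModuleCat.{u} Λ) :=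
  {P | Module.Projective Λ P}

/-- `add 𝒳`: the direct summands of finite direct sums of modules in `𝒳`. -/
def add (𝒳 : Set (FGModuleCat.{u} Λ)) : Set (FGModuleCat.{u} Λ) :=
  {M | ∃ (n : ℕ) (Y : Fin n → FGModuleCat.{u} Λ) (N : FGModuleCat.{u} Λ),
    (∀ i, Y i ∈ 𝒳) ∧ Nonempty ((M × N) ≃ₗ[Λ] (∀ i, Y i))}

/-- `Z` is a direct summand of `X`. -/
def IsSummand (Z X : FGModuleCat.{u} Λ) : Prop :=
  ∃ N : FGModuleCat.{u} Λ, Nonempty ((Z × N) ≃ₗ[Λ] X)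

/-- `M` is indecomposable: it is nonzero and not a direct sum of two nonzero modules. -/
def IsIndecomposable (M : FGModuleCat.{u} Λ) : Prop :=
  Nontrivial M ∧ ∀ X Y : FGModuleCat.{u} Λ, Nonempty (M ≃ₗ[Λ] (X × Y)) →
    Subsingleton X ∨ Subsingleton Y

end Classes

/-! ### Homological dimensions and orthogonal classes -/

section Dimensions

variable {Λ : Type u} [Ring Λ]

/-- `Ext^i_Λ(M, N) = 0`. -/
def ExtVanishes (M N : FGModuleCat.{u} Λ) (i : ℕ) : Prop :=
  Subsingleton (Abelian.Ext M.obj N.obj i)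

/-- The projective dimension `min {n | Ext^j(M, -) = 0 on mod Λ for all j > n}`, with
`min ∅ = ∞`. In particular the zero module has projective dimension `0`. -/
def projDim (M : FGModuleCat.{u} Λ) : ℕ∞ :=
  sInf ((fun n : ℕ => (n : ℕ∞)) ''
    {n | ∀ j, n < j → ∀ N : FGModuleCat.{u} Λ, ExtVanishes M N j})

/-- The injective dimension `min {n | Ext^j(-, M) = 0 on mod Λ for all j > n}`, with
`min ∅ = ∞`. -/
def injDim (M : FGModuleCat.{u} Λ) : ℕ∞ :=
  sInf ((fun n : ℕ => (n : ℕ∞)) ''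
    {n | ∀ j, n < j → ∀ N : FGModuleCat.{u} Λ, ExtVanishes N M j})

/-- The finitistic dimension `sup {pd X | X ∈ 𝒳, pd X < ∞}` of a class. -/
def finDim (𝒳 : Set (FGModuleCat.{u} Λ)) : ℕ∞ :=
  sSup (projDim '' {X | X ∈ 𝒳 ∧ projDim X < ⊤})

/-- The left orthogonal class `{M | Ext^i(M, T) = 0 for all i ≥ 1}` of a module `T`. -/
def leftPerp (T : FGModuleCat.{u} Λ) : Set (FGModuleCat.{u} Λ) :=
  {M | ∀ i, 1 ≤ i → ExtVanishes M T i}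

/-- `HasResolution 𝒳 n M`: there is an exact sequence `0 → X_n → ⋯ → X_0 → M → 0` with all
`X_i` in `𝒳`, built up by splicing short exact sequences. -/
def HasResolution (𝒳 : Set (FGModuleCat.{u} Λ)) : ℕ → FGModuleCat.{u} Λ → Prop
  | 0, M => ∃ X ∈ 𝒳, Nonempty (X ≃ₗ[Λ] M)
  | n + 1, M => ∃ (K X : FGModuleCat.{u} Λ) (f : K →ₗ[Λ] X) (g : X →ₗ[Λ] M),
      HasResolution 𝒳 n K ∧ X ∈ 𝒳 ∧
        Function.Injective f ∧ Function.Exact f g ∧ Function.Surjective g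

/-- The `𝒳`-resolution dimension of `M`. -/
def resDim (𝒳 : Set (FGModuleCat.{u} Λ)) (M : FGModuleCat.{u} Λ) : ℕ∞ :=
  sInf ((fun n : ℕ => (n : ℕ∞)) '' {n | HasResolution 𝒳 n M})

/-- `T` is a cotilting module (Miyashita). -/
structure IsCotilting (T : FGModuleCat.{u} Λ) : Prop where
  injDim_lt_top : injDim T < ⊤
  ext_self : ∀ i, 0 < i → ExtVanishes T T i
  resDim_lt_top : ∀ I : FGModuleCat.{u} Λ, Module.Injective Λ I → resDim (add {T}) I < ⊤

end Dimensions

/-! ### Projective covers and syzygies -/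

section Cover

variable {Λ : Type u} [Ring Λ]

/-- `π : P → M` is a projective cover: `P` is projective and `π` is surjective with superfluous
kernel. -/
structure IsProjectiveCover {P M : Type*} [AddCommGroup P] [Module Λ P] [AddCommGroup M]
    [Module Λ M] (π : P →ₗ[Λ] M) : Prop where
  projective : Module.Projective Λ P
  surjective : Function.Surjective π
  superfluous : ∀ N : Submodule Λ P, N ⊔ LinearMap.ker π = ⊤ → N = ⊤

theorem IsProjectiveCover.surjective_of_comp {P M N : Type*} [AddCommGroup P] [Module Λ P]
    [AddCommGroup M] [Module Λ M] [AddCommGroup N] [Module Λ N] {π : P →ₗ[Λ] M}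
    (h : IsProjectiveCover π) (f : N →ₗ[Λ] P) (hf : Function.Surjective (π ∘ₗ f)) :
    Function.Surjective f := by
  rw [← LinearMap.range_eq_top]
  apply h.superfluous
  rw [eq_top_iff]
  intro x _
  obtain ⟨y, hy⟩ := hf (π x)
  refine Submodule.mem_sup.2 ⟨f y, ⟨y, rfl⟩, x - f y, ?_, by abel⟩
  simp only [LinearMap.comp_apply] at hy
  simp [hy]

theorem IsProjectiveCover.injective_of_projective {P M : Type*} [AddCommGroup P] [Module Λ P]
    [AddCommGroup M] [Module Λ M] [Module.Projective Λ M] {π : P →ₗ[Λ] M}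
    (h : IsProjectiveCover π) : Function.Injective π := by
  obtain ⟨s, hs⟩ := Module.projective_lifting_property π LinearMap.id h.surjective
  have hs' : ∀ x, π (s x) = x := fun x => LinearMap.congr_fun hs x
  have : Function.Surjective s := h.surjective_of_comp s (by rw [hs]; exact fun x => ⟨x, rfl⟩)
  intro x y hxy
  obtain ⟨a, rfl⟩ := this x
  obtain ⟨b, rfl⟩ := this y
  rw [hs', hs'] at hxy
  rw [hxy]

/-- Isomorphic modules have isomorphic kernels of projective covers. -/
theorem IsProjectiveCover.nonempty_ker_equiv {P Q M N : Type*} [AddCommGroup P] [Module Λ P]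
    [AddCommGroup Q] [Module Λ Q] [AddCommGroup M] [Module Λ M] [AddCommGroup N] [Module Λ N]
    [IsNoetherian Λ P] {π : P →ₗ[Λ] M} {ρ : Q →ₗ[Λ] N}
    (hπ : IsProjectiveCover π) (hρ : IsProjectiveCover ρ) (e : M ≃ₗ[Λ] N) :
    Nonempty (LinearMap.ker π ≃ₗ[Λ] LinearMap.ker ρ) := by
  have := hπ.projective
  have := hρ.projective
  obtain ⟨f, hf⟩ := Module.projective_lifting_property ρ (e.toLinearMap ∘ₗ π) hρ.surjective
  obtain ⟨g, hg⟩ := Module.projective_lifting_property π (e.symm.toLinearMap ∘ₗ ρ) hπ.surjective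
  have hf' : ∀ x, ρ (f x) = e (π x) := fun x => LinearMap.congr_fun hf x
  have hg' : ∀ x, π (g x) = e.symm (ρ x) := fun x => LinearMap.congr_fun hg x
  have hfs : Function.Surjective f := hρ.surjective_of_comp f (by
    rw [hf]; exact e.surjective.comp hπ.surjective)
  have hgs : Function.Surjective g := hπ.surjective_of_comp g (by
    rw [hg]; exact e.symm.surjective.comp hρ.surjective)
  have hgf : Function.Injective (g ∘ₗ f) :=
    IsNoetherian.injective_of_surjective_endomorphism (g ∘ₗ f) (hgs.comp hfs)
  have hfi : Function.Injective f := fun x y hxy => hgf (congrArg g hxy)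
  let F : P ≃ₗ[Λ] Q := LinearEquiv.ofBijective f ⟨hfi, hfs⟩
  refine ⟨F.ofSubmodules _ _ ?_⟩
  ext x
  simp only [Submodule.mem_map, LinearMap.mem_ker]
  constructor
  · rintro ⟨y, hy, rfl⟩
    change ρ (f y) = 0
    rw [hf', hy, map_zero]
  · intro hx
    obtain ⟨y, rfl⟩ := hfs x
    refine ⟨y, ?_, rfl⟩
    rw [hf'] at hx
    exact e.map_eq_zero_iff.1 hx

theorem IsProjectiveCover.prodMap {P Q M N : Type*} [AddCommGroup P] [Module Λ P]
    [AddCommGroup Q] [Module Λ Q] [AddCommGroup M] [Module Λ M] [AddCommGroup N] [Module Λ N]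
    {π : P →ₗ[Λ] M} {ρ : Q →ₗ[Λ] N} (hπ : IsProjectiveCover π) (hρ : IsProjectiveCover ρ) :
    IsProjectiveCover (π.prodMap ρ) := by
  have := hπ.projective
  have := hρ.projective
  refine ⟨inferInstance, Function.Surjective.prodMap hπ.surjective hρ.surjective, ?_⟩
  intro U hU
  -- first, every `p : P` is the first coordinate of an element of `U` with second coordinate
  -- in the kernel of `ρ`
  have h1 : (U ⊓ LinearMap.ker (ρ ∘ₗ LinearMap.snd Λ P Q)).map (LinearMap.fst Λ P Q) = ⊤ := by
    apply hπ.superfluous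
    rw [eq_top_iff]
    intro p _
    have : ((p, 0) : P × Q) ∈ U ⊔ LinearMap.ker (π.prodMap ρ) := hU ▸ Submodule.mem_top
    obtain ⟨a, ha, b, hb, hab⟩ := Submodule.mem_sup.1 this
    have hb1 : π b.1 = 0 := congrArg Prod.fst (LinearMap.mem_ker.1 hb)
    have hb2 : ρ b.2 = 0 := congrArg Prod.snd (LinearMap.mem_ker.1 hb)
    have e1 : a.1 + b.1 = p := congrArg Prod.fst hab
    have e2 : a.2 + b.2 = 0 := congrArg Prod.snd hab
    refine Submodule.mem_sup.2 ⟨a.1, ⟨a, ⟨ha, ?_⟩, rfl⟩, b.1, hb1, e1⟩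
    change ρ a.2 = 0
    rw [eq_neg_of_add_eq_zero_left e2, map_neg, hb2, neg_zero]
  have h2 : U.comap (LinearMap.inr Λ P Q) = ⊤ := by
    apply hρ.superfluous
    rw [eq_top_iff]
    intro q _
    have : ((0, q) : P × Q) ∈ U ⊔ LinearMap.ker (π.prodMap ρ) := hU ▸ Submodule.mem_top
    obtain ⟨a, ha, b, hb, hab⟩ := Submodule.mem_sup.1 this
    have hb2 : ρ b.2 = 0 := congrArg Prod.snd (LinearMap.mem_ker.1 hb)
    have e2 : a.2 + b.2 = q := congrArg Prod.snd hab
    obtain ⟨c, ⟨hc, hc2⟩, hc1⟩ :=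
      (h1 ▸ Submodule.mem_top : a.1 ∈ (U ⊓ LinearMap.ker (ρ ∘ₗ LinearMap.snd Λ P Q)).map
        (LinearMap.fst Λ P Q))
    have hc1' : c.1 = a.1 := hc1
    have hc2' : ρ c.2 = 0 := hc2
    refine Submodule.mem_sup.2 ⟨a.2 - c.2, ?_, c.2 + b.2, ?_, ?_⟩
    · have := U.sub_mem ha hc
      change ((0, a.2 - c.2) : P × Q) ∈ U
      convert this using 1
      ext <;> simp [hc1']
    · simp [hc2', hb2]
    · rw [← e2]; abel
  rw [eq_top_iff]
  rintro ⟨p, q⟩ _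
  obtain ⟨c, ⟨hc, -⟩, hc1⟩ :=
    (h1 ▸ Submodule.mem_top : p ∈ (U ⊓ LinearMap.ker (ρ ∘ₗ LinearMap.snd Λ P Q)).map
      (LinearMap.fst Λ P Q))
  have hc1' : c.1 = p := hc1
  have h3 : ((0, q - c.2) : P × Q) ∈ U :=
    (h2 ▸ Submodule.mem_top : q - c.2 ∈ U.comap (LinearMap.inr Λ P Q))
  have := U.add_mem hc h3
  convert this using 1
  ext <;> simp [hc1']

/-- Over an artinian ring every finitely generated module has a projective cover. -/
theorem exists_projectiveCover [IsArtinianRing Λ] (M : FGModuleCat.{u} Λ) :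
    ∃ (P : FGModuleCat.{u} Λ) (π : P →ₗ[Λ] M), IsProjectiveCover π := by
  obtain ⟨n, p, hp⟩ := Module.Finite.exists_fin' Λ M
  let S : Set (Submodule Λ (Fin n → Λ)) :=
    {Q | Module.Projective Λ Q ∧ Function.Surjective (p ∘ₗ Q.subtype)}
  have hS : S.Nonempty := by
    refine ⟨⊤, Module.Projective.of_equiv' (Submodule.topEquiv (R := Λ)).symm, ?_⟩
    intro m
    obtain ⟨x, hx⟩ := hp m
    exact ⟨⟨x, trivial⟩, hx⟩
  obtain ⟨Q, ⟨hQ1, hQ2⟩, hmin⟩ :=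
    WellFounded.has_min (IsWellFounded.wf : WellFounded ((· < ·) :
      Submodule Λ (Fin n → Λ) → Submodule Λ (Fin n → Λ) → Prop)) S hS
  refine ⟨FGModuleCat.of Λ Q, p ∘ₗ Q.subtype, hQ1, hQ2, ?_⟩
  change ∀ N : Submodule Λ Q, N ⊔ LinearMap.ker (p ∘ₗ Q.subtype) = ⊤ → N = ⊤
  intro N hN
  set π : Q →ₗ[Λ] M := p ∘ₗ Q.subtype with hπ
  have hNs : Function.Surjective (π ∘ₗ N.subtype) := by
    intro m
    obtain ⟨x, rfl⟩ := hQ2 m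
    obtain ⟨a, ha, b, hb, rfl⟩ := Submodule.mem_sup.1 (hN ▸ Submodule.mem_top : x ∈ _)
    refine ⟨⟨a, ha⟩, ?_⟩
    have hb' : π b = 0 := hb
    simp [hb']
  obtain ⟨g, hg⟩ := Module.projective_lifting_property (π ∘ₗ N.subtype) π hNs
  let f : Module.End Λ Q := N.subtype ∘ₗ g
  have hf : ∀ x, π (f x) = π x := fun x => LinearMap.congr_fun hg x
  have hfk : ∀ (k : ℕ) (x : Q), π ((f ^ k) x) = π x := by
    intro k
    induction k with
    | zero => intro x; rfl
    | succ k ih => intro x; rw [pow_succ, Module.End.mul_apply, ih, hf]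
  obtain ⟨k, hk⟩ := Filter.eventually_atTop.1 (LinearMap.eventually_isCompl_ker_pow_range_pow f)
  have hc := hk (k + 1) (Nat.le_succ k)
  set r : Submodule Λ Q := LinearMap.range (f ^ (k + 1)) with hr
  have hrproj : Module.Projective Λ r := by
    refine Module.Projective.of_split r.subtype (r.projectionOnto _ hc.symm) ?_
    ext x
    simp
  have hrS : r.map Q.subtype ∈ S := by
    refine ⟨Module.Projective.of_equiv'
      (Submodule.equivMapOfInjective Q.subtype Q.injective_subtype r), ?_⟩
    intro m
    obtain ⟨x, rfl⟩ := hQ2 m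
    refine ⟨⟨((f ^ (k + 1)) x : Q), ⟨(f ^ (k + 1)) x, ⟨x, rfl⟩, rfl⟩⟩, ?_⟩
    exact hfk (k + 1) x
  have hrQ : r.map Q.subtype = Q := by
    have hle : r.map Q.subtype ≤ Q := Submodule.map_subtype_le Q r
    exact (lt_or_eq_of_le hle).resolve_left (hmin _ hrS)
  rw [eq_top_iff]
  intro x _
  have hx : (x : Fin n → Λ) ∈ r.map Q.subtype := hrQ.symm ▸ x.2
  obtain ⟨y, ⟨z, hz⟩, hyx⟩ := hx
  have : y = x := Subtype.ext hyx
  rw [← this, ← hz, pow_succ', Module.End.mul_apply]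
  exact (g _).2

variable [IsArtinianRing Λ]

/-- A chosen projective cover `P(M) → M`. -/
def coverObj (M : FGModuleCat.{u} Λ) : FGModuleCat.{u} Λ :=
  (exists_projectiveCover M).choose

def cover (M : FGModuleCat.{u} Λ) : coverObj M →ₗ[Λ] M :=
  (exists_projectiveCover M).choose_spec.choose

theorem isProjectiveCover_cover (M : FGModuleCat.{u} Λ) : IsProjectiveCover (cover M) :=
  (exists_projectiveCover M).choose_spec.choose_spec

/-- The syzygy `Ω M`, the kernel of the projective cover of `M`. -/
def syzygy (M : FGModuleCat.{u} Λ) : FGModuleCat.{u} Λ :=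
  FGModuleCat.of Λ (LinearMap.ker (cover M))

theorem syzygy_equiv {M N : FGModuleCat.{u} Λ} (e : M ≃ₗ[Λ] N) :
    Nonempty (syzygy M ≃ₗ[Λ] syzygy N) :=
  (isProjectiveCover_cover M).nonempty_ker_equiv (isProjectiveCover_cover N) e

theorem syzygy_prod {M X Y : FGModuleCat.{u} Λ} (e : M ≃ₗ[Λ] (X × Y)) :
    Nonempty (syzygy M ≃ₗ[Λ] (syzygy X × syzygy Y)) := by
  obtain ⟨e'⟩ := (isProjectiveCover_cover M).nonempty_ker_equiv
    ((isProjectiveCover_cover X).prodMap (isProjectiveCover_cover Y)) e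
  let F : LinearMap.ker ((cover X).prodMap (cover Y)) ≃ₗ[Λ]
      (LinearMap.ker (cover X) × LinearMap.ker (cover Y)) :=
    { toFun := fun x => (⟨x.1.1, congrArg Prod.fst x.2⟩, ⟨x.1.2, congrArg Prod.snd x.2⟩)
      invFun := fun y => ⟨(y.1.1, y.2.1), Prod.ext y.1.2 y.2.2⟩
      map_add' := fun _ _ => rfl
      map_smul' := fun _ _ => rfl
      left_inv := fun _ => rfl
      right_inv := fun _ => rfl }
  exact ⟨e'.trans F⟩

theorem subsingleton_syzygy (P : FGModuleCat.{u} Λ) [Module.Projective Λ P] :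
    Subsingleton (syzygy P) := by
  have h := LinearMap.ker_eq_bot.2 (isProjectiveCover_cover P).injective_of_projective
  change Subsingleton (LinearMap.ker (cover P))
  rw [h]
  infer_instance

end Cover

/-! ### The group `K`, the operator `[M] ↦ [Ω M]` and the Igusa-Todorov functions -/

section IgusaTodorov

/-- The isomorphism classes of finitely generated modules. -/
abbrev IsoClass (Λ : Type u) [Ring Λ] : Type (u + 1) :=
  Quotient (isIsomorphicSetoid (FGModuleCat.{u} Λ))

def isoClass {Λ : Type u} [Ring Λ] (M : FGModuleCat.{u} Λ) : IsoClass Λ :=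
  Quotient.mk (isIsomorphicSetoid (FGModuleCat.{u} Λ)) M

theorem isoClass_eq {Λ : Type u} [Ring Λ] {M N : FGModuleCat.{u} Λ} (e : M ≃ₗ[Λ] N) :
    isoClass M = isoClass N :=
  Quotient.sound (s := isIsomorphicSetoid (FGModuleCat.{u} Λ)) ⟨e.toFGModuleCatIso⟩

/-- The subgroup generated by all `[M] - [X] - [Y]` with `M ≃ X ⊕ Y`. -/
def relations (Λ : Type u) [Ring Λ] : AddSubgroup (FreeAbelianGroup (IsoClass Λ)) :=
  AddSubgroup.closure {r | ∃ M X Y : FGModuleCat.{u} Λ, Nonempty (M ≃ₗ[Λ] (X × Y)) ∧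
    r = FreeAbelianGroup.of (isoClass M) - FreeAbelianGroup.of (isoClass X)
      - FreeAbelianGroup.of (isoClass Y)}

/-- The split Grothendieck group `K` of `mod Λ`. -/
abbrev K (Λ : Type u) [Ring Λ] : Type (u + 1) :=
  FreeAbelianGroup (IsoClass Λ) ⧸ relations Λ

variable {Λ : Type u} [Ring Λ]

/-- The class `[M]` in `K`. -/
def cls (M : FGModuleCat.{u} Λ) : K Λ :=
  QuotientAddGroup.mk (FreeAbelianGroup.of (isoClass M))

theorem cls_prod {M X Y : FGModuleCat.{u} Λ} (e : M ≃ₗ[Λ] (X × Y)) :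
    cls M = cls X + cls Y := by
  have h : FreeAbelianGroup.of (isoClass M) - FreeAbelianGroup.of (isoClass X)
      - FreeAbelianGroup.of (isoClass Y) ∈ relations Λ :=
    AddSubgroup.subset_closure ⟨M, X, Y, ⟨e⟩, rfl⟩
  have h' := (QuotientAddGroup.eq_zero_iff _).2 h
  rw [QuotientAddGroup.mk_sub, QuotientAddGroup.mk_sub, sub_sub, sub_eq_zero] at h'
  exact h'

theorem cls_eq_zero (M : FGModuleCat.{u} Λ) [Subsingleton M] : cls M = 0 := by
  have e : M ≃ₗ[Λ] (M × M) :=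
    { (0 : M →ₗ[Λ] M × M) with
      invFun := 0
      left_inv := fun _ => Subsingleton.elim _ _
      right_inv := fun _ => Subsingleton.elim _ _ }
  simpa using cls_prod e

/-- `⟨𝒳⟩`: the subgroup of `K` generated by the classes of the indecomposable modules which
lie in `𝒳` or are projective. -/
def gen (𝒳 : Set (FGModuleCat.{u} Λ)) : AddSubgroup (K Λ) :=
  AddSubgroup.closure (cls '' {M | IsIndecomposable M ∧ M ∈ 𝒳 ∪ projectives Λ})

/-- `K_𝒫 = K / ⟨𝒫⟩`, where `𝒫` is the class of projective modules. -/
abbrev KP (Λ : Type u) [Ring Λ] : Type (u + 1) := K Λ ⧸ gen (projectives Λ)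

variable [IsArtinianRing Λ]

/-- The map `[M] ↦ [Ω M]` on isomorphism classes. -/
def syzygyCls : IsoClass Λ → K Λ :=
  Quotient.lift (fun M => cls (syzygy M)) (fun M N h => by
    obtain ⟨i⟩ := (h : IsIsomorphic M N)
    obtain ⟨e⟩ := syzygy_equiv (FGModuleCat.isoToLinearEquiv i)
    exact congrArg (fun c => (QuotientAddGroup.mk (FreeAbelianGroup.of c) : K Λ))
      (isoClass_eq e))

/-- The endomorphism `L` of `K` with `L [M] = [Ω M]`. -/
def L : K Λ →+ K Λ :=
  QuotientAddGroup.lift (relations Λ) (FreeAbelianGroup.lift syzygyCls) (by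
    refine (AddSubgroup.closure_le _).2 ?_
    rintro _ ⟨M, X, Y, ⟨e⟩, rfl⟩
    obtain ⟨e'⟩ := syzygy_prod e
    have h : cls (syzygy M) = cls (syzygy X) + cls (syzygy Y) := cls_prod e'
    change FreeAbelianGroup.lift syzygyCls _ = 0
    rw [map_sub, map_sub, FreeAbelianGroup.lift_apply_of, FreeAbelianGroup.lift_apply_of,
      FreeAbelianGroup.lift_apply_of]
    change cls (syzygy M) - cls (syzygy X) - cls (syzygy Y) = 0
    rw [h]
    abel)

theorem L_cls (M : FGModuleCat.{u} Λ) : L (cls M) = cls (syzygy M) :=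
  FreeAbelianGroup.lift_apply_of _ _

theorem gen_projectives_le : gen (projectives Λ) ≤ (gen (projectives Λ)).comap L := by
  refine (AddSubgroup.closure_le _).2 ?_
  rintro _ ⟨P, ⟨-, hP⟩, rfl⟩
  have : Module.Projective Λ P := hP.elim id id
  have := subsingleton_syzygy P
  change L (cls P) ∈ gen (projectives Λ)
  rw [L_cls, cls_eq_zero]
  exact zero_mem _

/-- The endomorphism of `K_𝒫` induced by `L`. -/
def Lbar : KP Λ →+ KP Λ :=
  QuotientAddGroup.map (gen (projectives Λ)) (gen (projectives Λ)) L gen_projectives_le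

/-- `η_f(X)`: the least `k` such that `f` restricts to an isomorphism
`f^m(X) → f^{m+1}(X)` for all `m ≥ k`. By Fitting's lemma such a `k` exists when `X` is a
finitely generated group. -/
def eta {G : Type*} [AddCommGroup G] (f : G →+ G) (X : AddSubgroup G) : ℕ :=
  sInf {k : ℕ | ∀ m, k ≤ m → Set.BijOn f (f^[m] '' X) (f^[m + 1] '' X)}

/-- The Igusa-Todorov function `Φ`. -/
def Phi (X : FGModuleCat.{u} Λ) : ℕ :=
  eta Lbar ((gen (add {X})).map (QuotientAddGroup.mk' (gen (projectives Λ))))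

/-- The Igusa-Todorov function `Ψ(X) = Φ(X) + fin.dim {Z | Z a summand of Ω^{Φ(X)} X}`. -/
def Psi (X : FGModuleCat.{u} Λ) : ℕ∞ :=
  (Phi X : ℕ∞) + finDim {Z | IsSummand Z (syzygy^[Phi X] X)}

/-- `Φdim(𝒳) = sup {Φ(X) | X ∈ 𝒳}`. -/
def PhiDim (𝒳 : Set (FGModuleCat.{u} Λ)) : ℕ∞ :=
  sSup ((fun X => (Phi X : ℕ∞)) '' 𝒳)

/-- `Ψdim(𝒳) = sup {Ψ(X) | X ∈ 𝒳}`. -/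
def PsiDim (𝒳 : Set (FGModuleCat.{u} Λ)) : ℕ∞ :=
  sSup (Psi '' 𝒳)

end IgusaTodorov

/-- The Artin algebra `Λ` is an `(n, V, 𝒟)`-Lat-Igusa-Todorov algebra. -/
structure IsLITAlgebra (Λ : Type u) [Ring Λ] [IsArtinAlgebra Λ] (n : ℕ) (V : FGModuleCat.{u} Λ)
    (𝒟 : Set (FGModuleCat.{u} Λ)) : Prop where
  add_eq : add 𝒟 = 𝒟
  syzygy_mem : ∀ M ∈ 𝒟, syzygy M ∈ 𝒟
  phiDim_eq_zero : PhiDim 𝒟 = 0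
  exists_exact : ∀ M : FGModuleCat.{u} Λ, ∃ V₁ ∈ add {V}, ∃ V₀ ∈ add {V}, ∃ D₁ ∈ 𝒟, ∃ D₀ ∈ 𝒟,
    ∃ (f : (V₁ × D₁) →ₗ[Λ] (V₀ × D₀)) (g : (V₀ × D₀) →ₗ[Λ] (syzygy^[n] M)),
      Function.Injective f ∧ Function.Exact f g ∧ Function.Surjective g

end LIT

end

/-! The bound `injDim T ≤ 1` puts every syzygy into the orthogonal class: `Ext^i(ΩM, T) ≅
Ext^(i+1)(M, T) = 0` for `i ≥ 1` (`syzygy_mem_leftPerp_of_injDim_le_one`). So the projective cover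
sequence of `Ω^n M` has its first two terms in `⊥T`, and this is the LIT sequence.

For the dimensions, `Φ(X) ≤ Φ(ΩX) + 1` (`Phi_le_Phi_syzygy_add_one`) and `Φ = 0` on `⊥T` give `Φdim
Λ ≤ 1`, while `projDim_le_Phi` gives `fin.dim ≤ Φdim` on any class. If `Φ(X) = 0`, then `Ψ(X)` is a
finitistic dimension, hence at most `Φdim Λ ≤ 1`. If `Φ(X) = 1`, the summands of `ΩX` lie in `⊥T`,
whose finitistic dimension is at most `Φdim(⊥T) = 0`.

Two facts support this. The subgroup of `K_𝒫` attached to `X` is finitely generated, by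
Krull-Schmidt, so Fitting's lemma makes the infimum defining `Φ` an attained one. And a class in
`K_𝒫` vanishes only for projective modules (`clsP_eq_zero_iff`). -/

namespace LIT

open Abelian

/-! ### Ext vanishing, direct summands and the orthogonal class. -/

section Ext

variable {Λ : Type u} [Ring Λ]

/-- The bound rules out `sInf ∅ = ⊤`, and a nonempty set in `ℕ∞` attains its infimum. -/
theorem sInf_coe_image_le_iff {p : ℕ → Prop} {n : ℕ} :
    sInf ((fun n : ℕ => (n : ℕ∞)) '' {n | ∀ j, n < j → p j}) ≤ n ↔ ∀ j, n < j → p j := by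
  constructor
  · intro h
    have hne : ((fun n : ℕ => (n : ℕ∞)) '' {n | ∀ j, n < j → p j}).Nonempty := by
      by_contra hne
      rw [Set.not_nonempty_iff_eq_empty.1 hne, sInf_empty] at h
      exact absurd h (by simp)
    obtain ⟨k, hk, hk'⟩ := csInf_mem hne
    rw [← hk'] at h
    exact fun j hj => hk j (lt_of_le_of_lt (Nat.cast_le.1 h) hj)
  · exact fun h => sInf_le ⟨n, h, rfl⟩

theorem projDim_le_iff {M : FGModuleCat.{u} Λ} {n : ℕ} :
    projDim M ≤ n ↔ ∀ j, n < j → ∀ N : FGModuleCat.{u} Λ, ExtVanishes M N j :=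
  sInf_coe_image_le_iff (p := fun j => ∀ N : FGModuleCat.{u} Λ, ExtVanishes M N j)

theorem injDim_le_iff {M : FGModuleCat.{u} Λ} {n : ℕ} :
    injDim M ≤ n ↔ ∀ j, n < j → ∀ N : FGModuleCat.{u} Λ, ExtVanishes N M j :=
  sInf_coe_image_le_iff (p := fun j => ∀ N : FGModuleCat.{u} Λ, ExtVanishes N M j)

/-- The vanishing of `Ext^i(-, N)` passes from the `Y k` to any module whose identity is a sum of
endomorphisms factoring through them. -/
theorem ExtVanishes.of_sum_comp_eq_id {M N : FGModuleCat.{u} Λ} {i : ℕ} {ι : Type*} [Fintype ι]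
    {Y : ι → FGModuleCat.{u} Λ} (b : ∀ k, M →ₗ[Λ] Y k) (a : ∀ k, Y k →ₗ[Λ] M)
    (h : ∑ k, a k ∘ₗ b k = LinearMap.id) (hY : ∀ k, ExtVanishes (Y k) N i) :
    ExtVanishes M N i := by
  refine subsingleton_of_forall_eq 0 fun x => ?_
  have hid : 𝟙 M.obj = ∑ k, ((ModuleCat.ofHom (b k) : M.obj ⟶ (Y k).obj) ≫
      (ModuleCat.ofHom (a k) : (Y k).obj ⟶ M.obj)) := by
    ext x
    simpa using (LinearMap.congr_fun h x).symm
  rw [← Ext.mk₀_id_comp x, hid, Ext.mk₀_sum, Ext.sum_comp]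
  refine Finset.sum_eq_zero fun k _ => ?_
  have : Subsingleton (Ext (Y k).obj N.obj i) := hY k
  rw [← Ext.mk₀_comp_mk₀, Ext.comp_assoc_of_second_deg_zero]
  rw [Subsingleton.elim ((Ext.mk₀ (ModuleCat.ofHom (a k) : (Y k).obj ⟶ M.obj)).comp x _) 0,
    Ext.comp_zero]

/-- Membership in `add` becomes an identity between maps, which suits both additive functors and the
local endomorphism ring argument. -/
theorem exists_sum_comp_eq_id_of_mem_add {𝒳 : Set (FGModuleCat.{u} Λ)} {M : FGModuleCat.{u} Λ}
    (hM : M ∈ add 𝒳) : ∃ (n : ℕ) (Y : Fin n → FGModuleCat.{u} Λ) (b : ∀ k, M →ₗ[Λ] Y k)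
      (a : ∀ k, Y k →ₗ[Λ] M), (∀ k, Y k ∈ 𝒳) ∧ ∑ k, a k ∘ₗ b k = LinearMap.id := by
  obtain ⟨n, Y, N, hY, ⟨e⟩⟩ := hM
  refine ⟨n, Y, fun k => LinearMap.proj k ∘ₗ e.toLinearMap ∘ₗ LinearMap.inl Λ M N,
    fun k => LinearMap.fst Λ M N ∘ₗ e.symm.toLinearMap ∘ₗ LinearMap.single Λ (fun i => Y i) k,
    hY, ?_⟩
  ext x
  simp only [LinearMap.coe_sum, Finset.sum_apply, LinearMap.comp_apply, LinearMap.id_apply,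
    LinearEquiv.coe_coe]
  rw [← map_sum, ← map_sum]
  have : ∑ k, (LinearMap.single Λ (fun i => Y i) k)
      ((LinearMap.proj k : (∀ i, Y i) →ₗ[Λ] Y k) (e (LinearMap.inl Λ M N x))) =
      e (LinearMap.inl Λ M N x) := by
    exact LinearMap.sum_single_apply (fun i => Y i) (e (LinearMap.inl Λ M N x))
  rw [this]
  simp

theorem IsSummand.mem_add {Z X : FGModuleCat.{u} Λ} {𝒳 : Set (FGModuleCat.{u} Λ)}
    (h : IsSummand Z X) (hX : X ∈ 𝒳) : Z ∈ add 𝒳 := by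
  obtain ⟨N, ⟨e⟩⟩ := h
  exact ⟨1, fun _ => X, N, fun _ => hX, ⟨e.trans (LinearEquiv.funUnique (Fin 1) Λ X).symm⟩⟩

theorem isSummand_of_equiv {M N : FGModuleCat.{u} Λ} (e : M ≃ₗ[Λ] N) : IsSummand M N :=
  ⟨FGModuleCat.of Λ PUnit.{u + 1}, ⟨(LinearEquiv.prodUnique (R := Λ) (M := M)
    (M₂ := PUnit.{u + 1})).trans e⟩⟩

theorem IsSummand.refl (M : FGModuleCat.{u} Λ) : IsSummand M M :=
  isSummand_of_equiv (LinearEquiv.refl Λ M)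

theorem IsSummand.trans {X Y Z : FGModuleCat.{u} Λ} (h : IsSummand X Y) (h' : IsSummand Y Z) :
    IsSummand X Z := by
  obtain ⟨N, ⟨e⟩⟩ := h
  obtain ⟨N', ⟨e'⟩⟩ := h'
  exact ⟨FGModuleCat.of Λ (N × N'), ⟨(LinearEquiv.prodAssoc Λ X N N').symm.trans
    ((e.prodCongr (LinearEquiv.refl Λ N')).trans e')⟩⟩

theorem isSummand_fst {M X Y : FGModuleCat.{u} Λ} (e : M ≃ₗ[Λ] (X × Y)) : IsSummand X M :=
  ⟨Y, ⟨e.symm⟩⟩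

theorem isSummand_snd {M X Y : FGModuleCat.{u} Λ} (e : M ≃ₗ[Λ] (X × Y)) : IsSummand Y M :=
  ⟨X, ⟨(LinearEquiv.prodComm Λ Y X).trans e.symm⟩⟩

/-- A module is a direct summand as soon as it is a retract. -/
theorem isSummand_of_comp_eq_id {M N : FGModuleCat.{u} Λ} [IsNoetherianRing Λ] (s : M →ₗ[Λ] N)
    (r : N →ₗ[Λ] M) (h : r ∘ₗ s = LinearMap.id) : IsSummand M N := by
  have h' : ∀ x, r (s x) = x := fun x => LinearMap.congr_fun h x
  -- The complement is `ker r`, finitely generated because `Λ` is noetherian.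
  refine ⟨FGModuleCat.of Λ (LinearMap.ker r), ⟨LinearEquiv.ofBijective
    (s.coprod (LinearMap.ker r).subtype) ⟨?_, ?_⟩⟩⟩
  · rw [← LinearMap.ker_eq_bot, LinearMap.ker_eq_bot']
    rintro ⟨x, y⟩ hxy
    have hxy' : s x + (y : N) = 0 := hxy
    have hy : r (y : N) = 0 := y.2
    have hx : x = 0 := by simpa [h', hy] using congrArg r hxy'
    subst hx
    ext
    · rfl
    · simpa using hxy'
  · intro n
    refine ⟨(r n, ⟨n - s (r n), by simp [h']⟩), ?_⟩
    change s (r n) + (n - s (r n)) = n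
    abel

theorem IsSummand.exists_comp_eq_id {M N : FGModuleCat.{u} Λ} (h : IsSummand M N) :
    ∃ (s : M →ₗ[Λ] N) (r : N →ₗ[Λ] M), r ∘ₗ s = LinearMap.id := by
  obtain ⟨Z, ⟨e⟩⟩ := h
  exact ⟨e.toLinearMap ∘ₗ LinearMap.inl Λ M Z, LinearMap.fst Λ M Z ∘ₗ e.symm.toLinearMap, by
    ext; simp⟩

theorem IsSummand.projective {M N : FGModuleCat.{u} Λ} (h : IsSummand M N)
    [Module.Projective Λ N] : Module.Projective Λ M := by
  obtain ⟨s, r, h⟩ := h.exists_comp_eq_id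
  exact Module.Projective.of_split s r h

theorem add_leftPerp (T : FGModuleCat.{u} Λ) : add (leftPerp T) = leftPerp T := by
  refine Set.Subset.antisymm (fun M hM i hi => ?_) fun M hM => (IsSummand.refl M).mem_add hM
  obtain ⟨n, Y, b, a, hY, h⟩ := exists_sum_comp_eq_id_of_mem_add hM
  exact ExtVanishes.of_sum_comp_eq_id b a h fun k => hY k i hi

theorem extVanishes_of_projective (P N : FGModuleCat.{u} Λ) [Module.Projective Λ P] {i : ℕ}
    (hi : 1 ≤ i) : ExtVanishes P N i := by
  obtain ⟨i, rfl⟩ := Nat.exists_eq_add_of_le' hi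
  have : Projective P.obj := (IsProjective.iff_projective P).1 inferInstance
  exact Ext.subsingleton_of_projective P.obj N.obj i

theorem projective_mem_leftPerp (T P : FGModuleCat.{u} Λ) [Module.Projective Λ P] :
    P ∈ leftPerp T :=
  fun _ hi => extVanishes_of_projective P T hi

/-! ### Syzygies, dimension shifting and projective dimension. -/

variable [IsArtinianRing Λ]

instance projective_coverObj (M : FGModuleCat.{u} Λ) : Module.Projective Λ (coverObj M) :=
  (isProjectiveCover_cover M).projective

theorem shortExact_cover (M : FGModuleCat.{u} Λ) :
    (LinearMap.shortComplexKer (cover M)).ShortExact :=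
  LinearMap.shortExact_shortComplexKer (isProjectiveCover_cover M).surjective

/-- Dimension shifting. -/
theorem extVanishes_syzygy_iff (M N : FGModuleCat.{u} Λ) {i : ℕ} (hi : 1 ≤ i) :
    ExtVanishes (syzygy M) N i ↔ ExtVanishes M N (i + 1) := by
  have hS := shortExact_cover M
  have h0 : Subsingleton (Ext (coverObj M).obj N.obj i) := extVanishes_of_projective _ _ hi
  have h1 : Subsingleton (Ext (coverObj M).obj N.obj (i + 1)) :=
    extVanishes_of_projective _ _ (Nat.le_add_left 1 i)
  constructor
  · intro h
    have : Subsingleton (Ext (syzygy M).obj N.obj i) := h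
    refine subsingleton_of_forall_eq 0 fun x => ?_
    obtain ⟨y, rfl⟩ := Ext.contravariant_sequence_exact₃ hS N.obj x (h1.elim _ _) (add_comm 1 i)
    exact (congrArg (hS.extClass.comp · _) (this.elim y 0)).trans (Ext.comp_zero ..)
  · intro h
    have : Subsingleton (Ext M.obj N.obj (i + 1)) := h
    refine subsingleton_of_forall_eq 0 fun x => ?_
    obtain ⟨y, rfl⟩ := Ext.contravariant_sequence_exact₁ hS N.obj x (add_comm 1 i) (this.elim _ _)
    exact (congrArg ((Ext.mk₀ _).comp · _) (h0.elim y 0)).trans (Ext.comp_zero ..)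

theorem projective_of_subsingleton_syzygy {M : FGModuleCat.{u} Λ} (h : Subsingleton (syzygy M)) :
    Module.Projective Λ M := by
  refine Module.Projective.of_equiv' (LinearEquiv.ofBijective (cover M) ⟨?_,
    (isProjectiveCover_cover M).surjective⟩)
  rw [← LinearMap.ker_eq_bot]
  exact Submodule.subsingleton_iff_eq_bot.1 h

/-- The identity of `ΩM` extends to a retraction `ρ` of `ΩM → P(M)`. Then `ker ρ + ΩM = P(M)`, and
`ΩM` is superfluous, so `ρ = 0` and hence `ΩM = 0`. -/
theorem projective_of_extVanishes {M : FGModuleCat.{u} Λ} (h : ExtVanishes M (syzygy M) 1) :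
    Module.Projective Λ M := by
  have : Subsingleton (Ext M.obj (syzygy M).obj 1) := h
  obtain ⟨y, hy⟩ := Ext.contravariant_sequence_exact₁ (shortExact_cover M) (syzygy M).obj
    (Ext.mk₀ (𝟙 _)) (add_zero 1) (this.elim _ _)
  obtain ⟨r, rfl⟩ := Ext.homEquiv₀.symm.surjective y
  have hr := Ext.mk₀_bijective _ _ |>.1 ((Ext.mk₀_comp_mk₀ _ r).symm.trans hy)
  have hr' : ∀ x : LinearMap.ker (cover M), r.hom (x : coverObj M) = x :=
    fun x => LinearMap.congr_fun (congrArg ModuleCat.Hom.hom hr) x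
  let ρ : coverObj M →ₗ[Λ] LinearMap.ker (cover M) := r.hom
  have hker : LinearMap.ker ρ = ⊤ := by
    refine (isProjectiveCover_cover M).superfluous _ (eq_top_iff.2 fun x _ => ?_)
    exact Submodule.mem_sup.2 ⟨x - ρ x, by
      rw [LinearMap.mem_ker, map_sub, sub_eq_zero]
      exact (hr' (ρ x)).symm, ρ x, (ρ x).2, by abel⟩
  refine projective_of_subsingleton_syzygy (subsingleton_of_forall_eq 0 fun x => ?_)
  rw [← hr' x]
  exact LinearMap.mem_ker.1 (hker ▸ Submodule.mem_top)

theorem extVanishes_syzygy_iterate_iff (M N : FGModuleCat.{u} Λ) (n : ℕ) {i : ℕ} (hi : 1 ≤ i) :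
    ExtVanishes (syzygy^[n] M) N i ↔ ExtVanishes M N (i + n) := by
  induction n generalizing M with
  | zero => rfl
  | succ n ih =>
    rw [Function.iterate_succ_apply, ih, extVanishes_syzygy_iff _ _ (by omega), add_assoc]

/-- By dimension shifting, testing `Ext^(n+1)(M, -)` on the single module `Ω^(n+1) M` is enough. -/
theorem projDim_le_iff_projective {M : FGModuleCat.{u} Λ} {n : ℕ} :
    projDim M ≤ n ↔ Module.Projective Λ (syzygy^[n] M) := by
  rw [projDim_le_iff]
  constructor
  · intro h
    apply projective_of_extVanishes
    rw [extVanishes_syzygy_iterate_iff _ _ _ le_rfl]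
    exact h _ (by omega) _
  · intro h j hj N
    obtain ⟨i, rfl⟩ := Nat.exists_eq_add_of_lt hj
    rw [show n + i + 1 = (i + 1) + n by omega, ← extVanishes_syzygy_iterate_iff _ _ _ (by omega)]
    exact extVanishes_of_projective _ _ (by omega)

theorem syzygy_mem_leftPerp {T M : FGModuleCat.{u} Λ} (hM : M ∈ leftPerp T) :
    syzygy M ∈ leftPerp T :=
  fun i hi => (extVanishes_syzygy_iff M T hi).2 (hM _ (by omega))

/-- The degree shift takes `i ≥ 1` to `i + 1 > 1`, where `Ext(-, T)` vanishes. -/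
theorem syzygy_mem_leftPerp_of_injDim_le_one {T : FGModuleCat.{u} Λ} (hT : injDim T ≤ 1)
    (M : FGModuleCat.{u} Λ) : syzygy M ∈ leftPerp T :=
  fun i hi => (extVanishes_syzygy_iff M T hi).2
    ((injDim_le_iff (n := 1)).1 (by rwa [Nat.cast_one]) _ (by omega) _)

end Ext

/-- If `Φdim (⊥T) = 0` and `id T ≤ 1` then the projective cover of `Ω^n M` and its syzygy give the
exact sequence required of an `(n, 0, ⊥T)`-LIT-algebra. -/
theorem isLITAlgebra_leftPerp {Λ : Type u} [Ring Λ] [IsArtinAlgebra Λ] {T : FGModuleCat.{u} Λ}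
    (hΦ : PhiDim (leftPerp T) = 0) (hid : injDim T ≤ 1) (n : ℕ) :
    IsLITAlgebra Λ n (FGModuleCat.of Λ PUnit.{u + 1}) (leftPerp T) where
  add_eq := add_leftPerp T
  syzygy_mem _ := syzygy_mem_leftPerp
  phiDim_eq_zero := hΦ
  exists_exact M := by
    let N := syzygy^[n] M
    have h0 : FGModuleCat.of Λ PUnit.{u + 1} ∈ add {FGModuleCat.of Λ PUnit.{u + 1}} :=
      (IsSummand.refl _).mem_add rfl
    -- Both summands from `add V` are the zero module `PUnit`, so the sequence is `0 → ΩN → P(N) → N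
    -- → 0`.
    refine ⟨_, h0, _, h0, syzygy N, syzygy_mem_leftPerp_of_injDim_le_one hid N, coverObj N,
      projective_mem_leftPerp T _, LinearMap.prodMap LinearMap.id (LinearMap.ker (cover N)).subtype,
      cover N ∘ₗ LinearMap.snd Λ _ _, ?_, ?_, ?_⟩
    · exact Function.injective_id.prodMap (Submodule.injective_subtype _)
    · rintro ⟨x, y⟩
      constructor
      · intro h
        exact ⟨(x, ⟨y, h⟩), rfl⟩
      · rintro ⟨⟨x', y'⟩, h⟩
        rw [← h]
        exact y'.2
    · exact (isProjectiveCover_cover N).surjective.comp Prod.snd_surjective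

/-! ### Krull-Schmidt: decomposition into indecomposables. -/

section KrullSchmidt

variable {Λ : Type u} [Ring Λ] [IsArtinianRing Λ]

/-- The endomorphism ring of an indecomposable module is local. -/
theorem IsIndecomposable.isLocalRing_end {M : FGModuleCat.{u} Λ} (hM : IsIndecomposable M) :
    IsLocalRing (Module.End Λ M) := by
  have := hM.1
  refine IsLocalRing.of_isUnit_or_isUnit_one_sub_self fun f => ?_
  -- Fitting decomposition: one of kernel and image of a high power of `f` vanishes. The exponent `k
  -- + 1` is nonzero, so a unit power makes `f` a unit.
  obtain ⟨k, hk⟩ := Filter.eventually_atTop.1 (LinearMap.eventually_isCompl_ker_pow_range_pow f)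
  have hc := hk (k + 1) (Nat.le_succ k)
  rcases hM.2 (FGModuleCat.of Λ (LinearMap.ker (f ^ (k + 1))))
    (FGModuleCat.of Λ (LinearMap.range (f ^ (k + 1))))
    ⟨(Submodule.prodEquivOfIsCompl _ _ hc).symm⟩ with h | h
  · left
    have hker : LinearMap.ker (f ^ (k + 1)) = ⊥ := Submodule.subsingleton_iff_eq_bot.1 h
    have hrange : LinearMap.range (f ^ (k + 1)) = ⊤ := by
      have := hc.sup_eq_top
      rwa [hker, bot_sup_eq] at this
    exact (isUnit_pow_iff k.succ_ne_zero).1 ((Module.End.isUnit_iff _).2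
      ⟨LinearMap.ker_eq_bot.1 hker, LinearMap.range_eq_top.1 hrange⟩)
  · right
    have hrange : LinearMap.range (f ^ (k + 1)) = ⊥ := Submodule.subsingleton_iff_eq_bot.1 h
    exact IsNilpotent.isUnit_one_sub ⟨k + 1, LinearMap.range_eq_bot.1 hrange⟩

/-- In the local ring `End M` some term `a k ∘ b k` of the sum is a unit `u`, and `u⁻¹ ∘ a k` is a
retraction of `b k`. -/
theorem IsIndecomposable.exists_isSummand {M : FGModuleCat.{u} Λ} (hM : IsIndecomposable M)
    {ι : Type*} [Fintype ι] {Y : ι → FGModuleCat.{u} Λ} (b : ∀ k, M →ₗ[Λ] Y k)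
    (a : ∀ k, Y k →ₗ[Λ] M) (h : ∑ k, a k ∘ₗ b k = LinearMap.id) : ∃ k, IsSummand M (Y k) := by
  have := hM.isLocalRing_end
  obtain ⟨k, -, u, hu⟩ := IsLocalRing.exists_of_isUnit_sum (s := Finset.univ)
    (f := fun k => (a k ∘ₗ b k : Module.End Λ M)) (by rw [h]; exact isUnit_one)
  refine ⟨k, isSummand_of_comp_eq_id (b k) ((↑u⁻¹ : Module.End Λ M) ∘ₗ a k) ?_⟩
  rw [LinearMap.comp_assoc, ← hu]
  exact u.inv_mul

theorem IsIndecomposable.isSummand_of_mem_add {M X : FGModuleCat.{u} Λ} (hM : IsIndecomposable M)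
    (h : M ∈ add {X}) : IsSummand M X := by
  obtain ⟨n, Y, b, a, hY, h⟩ := exists_sum_comp_eq_id_of_mem_add h
  obtain ⟨k, hk⟩ := hM.exists_isSummand b a h
  rwa [← Set.mem_singleton_iff.1 (hY k)]

theorem IsIndecomposable.isSummand_of_prod {M Z X Y : FGModuleCat.{u} Λ} (hM : IsIndecomposable M)
    (h : IsSummand M Z) (e : Z ≃ₗ[Λ] (X × Y)) : IsSummand M X ∨ IsSummand M Y := by
  obtain ⟨s, r, h⟩ := h.exists_comp_eq_id
  let b : ∀ k : Bool, M →ₗ[Λ] (bif k then X else Y : FGModuleCat.{u} Λ) := fun k =>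
    match k with
    | true => LinearMap.fst Λ X Y ∘ₗ e.toLinearMap ∘ₗ s
    | false => LinearMap.snd Λ X Y ∘ₗ e.toLinearMap ∘ₗ s
  let a : ∀ k : Bool, (bif k then X else Y : FGModuleCat.{u} Λ) →ₗ[Λ] M := fun k =>
    match k with
    | true => r ∘ₗ e.symm.toLinearMap ∘ₗ LinearMap.inl Λ X Y
    | false => r ∘ₗ e.symm.toLinearMap ∘ₗ LinearMap.inr Λ X Y
  obtain ⟨k, hk⟩ := hM.exists_isSummand b a (by
    rw [Fintype.sum_bool, ← h]
    ext x
    change r (e.symm ((e (s x)).1, 0)) + r (e.symm (0, (e (s x)).2)) = r (s x)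
    rw [← map_add, ← map_add]
    simp)
  cases k
  · exact Or.inr hk
  · exact Or.inl hk

/-- Induction along the decomposition of a module into indecomposables. -/
theorem induction_indecomposable {p : FGModuleCat.{u} Λ → Prop}
    (zero : ∀ M : FGModuleCat.{u} Λ, Subsingleton M → p M)
    (indecomposable : ∀ M : FGModuleCat.{u} Λ, IsIndecomposable M → p M)
    (prod : ∀ M X Y : FGModuleCat.{u} Λ, (M ≃ₗ[Λ] (X × Y)) → p X → p Y → p M)
    (M : FGModuleCat.{u} Λ) : p M := by
  obtain ⟨n, hn⟩ : ∃ n : ℕ, Module.length Λ M = n :=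
    ⟨_, (ENat.natCast_toNat (Module.length_ne_top (R := Λ) (M := M))).symm⟩
  induction n using Nat.strong_induction_on generalizing M with
  | _ n ih =>
    rcases subsingleton_or_nontrivial M with h | h
    · exact zero M h
    by_cases hM : IsIndecomposable M
    · exact indecomposable M hM
    obtain ⟨X, Y, ⟨e⟩, hX, hY⟩ : ∃ X Y : FGModuleCat.{u} Λ, Nonempty (M ≃ₗ[Λ] (X × Y)) ∧
        Nontrivial X ∧ Nontrivial Y := by
      by_contra! hcon
      refine hM ⟨h, fun X Y e => or_iff_not_imp_left.2 fun hX => ?_⟩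
      exact hcon X Y e (not_subsingleton_iff_nontrivial.1 hX)
    obtain ⟨x, hx⟩ : ∃ n : ℕ, Module.length Λ X = n :=
      ⟨_, (ENat.natCast_toNat (Module.length_ne_top (R := Λ) (M := X))).symm⟩
    obtain ⟨y, hy⟩ : ∃ n : ℕ, Module.length Λ Y = n :=
      ⟨_, (ENat.natCast_toNat (Module.length_ne_top (R := Λ) (M := Y))).symm⟩
    have hx0 : 0 < Module.length Λ X := Module.length_pos
    have hy0 : 0 < Module.length Λ Y := Module.length_pos
    have hsum := e.length_eq
    rw [Module.length_prod, hn, hx, hy] at hsum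
    rw [hx] at hx0
    rw [hy] at hy0
    norm_cast at hsum hx0 hy0
    exact prod M X Y e (ih x (by omega) X hx) (ih y (by omega) Y hy)

theorem cls_mem_gen {𝒳 : Set (FGModuleCat.{u} Λ)} (M : FGModuleCat.{u} Λ)
    (h𝒳 : ∀ Z, IsIndecomposable Z → IsSummand Z M → Z ∈ 𝒳 ∪ projectives Λ) : cls M ∈ gen 𝒳 := by
  induction M using induction_indecomposable with
  | zero M h => rw [cls_eq_zero]; exact zero_mem _
  | indecomposable M h => exact AddSubgroup.subset_closure ⟨M, ⟨h, h𝒳 M h (IsSummand.refl M)⟩, rfl⟩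
  | prod M X Y e hX hY =>
    rw [cls_prod e]
    exact add_mem (hX fun Z hZ h => h𝒳 Z hZ (h.trans (isSummand_fst e)))
      (hY fun Z hZ h => h𝒳 Z hZ (h.trans (isSummand_snd e)))

/-- An indecomposable summand of `X × Y` is a summand of `X` or of `Y`, so finiteness passes up the
decomposition. This is the source of finite generation in `genP_fg`. -/
theorem finite_cls_isSummand (M : FGModuleCat.{u} Λ) :
    (cls '' {Z | IsIndecomposable Z ∧ IsSummand Z M}).Finite := by
  induction M using induction_indecomposable with
  | zero M h =>
    convert Set.finite_empty
    rw [Set.image_eq_empty, Set.eq_empty_iff_forall_notMem]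
    rintro Z ⟨⟨hZ, -⟩, N, ⟨e⟩⟩
    have : Subsingleton (Z × N) := e.toEquiv.subsingleton
    exact not_subsingleton Z (Prod.fst_surjective (β := N)).subsingleton
  | indecomposable M h =>
    refine (Set.finite_singleton (cls M)).subset ?_
    rintro _ ⟨Z, ⟨⟨hZ, -⟩, N, ⟨e⟩⟩, rfl⟩
    have : Subsingleton N := (h.2 Z N ⟨e.symm⟩).resolve_left (not_subsingleton Z)
    rw [Set.mem_singleton_iff, cls_prod e.symm, cls_eq_zero N, add_zero]
  | prod M X Y e hX hY =>
    refine (hX.union hY).subset ?_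
    rintro _ ⟨Z, ⟨hZ, h⟩, rfl⟩
    rcases hZ.isSummand_of_prod h e with h | h
    · exact Or.inl ⟨Z, ⟨hZ, h⟩, rfl⟩
    · exact Or.inr ⟨Z, ⟨hZ, h⟩, rfl⟩

end KrullSchmidt

/-! ### Fitting's lemma and the stabilization index `eta`. -/

section Eta

/-- Fitting's lemma for a finitely generated subgroup. -/
theorem exists_bijOn_iterate_image {G : Type*} [AddCommGroup G] (f : G →+ G) {X : AddSubgroup G}
    (hX : X.FG) : ∃ k, ∀ m, k ≤ m → Set.BijOn f (f^[m] '' X) (f^[m + 1] '' X) := by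
  have : AddGroup.FG X := (AddGroup.fg_iff_addSubgroup_fg X).2 hX
  have : Module.Finite ℤ X := Module.Finite.iff_addGroup_fg.2 this
  let g (m : ℕ) : X →ₗ[ℤ] G :=
    ((AddMonoidHom.mk' f^[m] fun a b => iterate_map_add f m a b).comp X.subtype).toIntLinearMap
  have hg (m : ℕ) (x : X) : g m x = f^[m] x := rfl
  -- The kernels of the `f^m` on the noetherian group `X` form an ascending chain. Once it is
  -- constant, `f` is injective on `f^m(X)`.
  let κ : ℕ →o Submodule ℤ X :=
    ⟨fun m => LinearMap.ker (g m), monotone_nat_of_le_succ fun m x hx => by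
      rw [LinearMap.mem_ker, hg] at hx ⊢
      rw [Function.iterate_succ_apply', hx, map_zero]⟩
  obtain ⟨k, hk⟩ := monotone_stabilizes_iff_noetherian.2 (inferInstance : IsNoetherian ℤ X) κ
  refine ⟨k, fun m hm => ⟨?_, ?_, ?_⟩⟩
  · rintro _ ⟨x, hx, rfl⟩
    exact ⟨x, hx, Function.iterate_succ_apply' ..⟩
  · rintro _ ⟨x, hx, rfl⟩ _ ⟨y, hy, rfl⟩ hxy
    have h1 : (⟨x, hx⟩ - ⟨y, hy⟩ : X) ∈ κ (m + 1) := by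
      change _ ∈ LinearMap.ker (g (m + 1))
      rw [LinearMap.mem_ker, map_sub, hg, hg, sub_eq_zero, Function.iterate_succ_apply',
        Function.iterate_succ_apply']
      exact hxy
    rw [← hk (m + 1) (by omega), hk m hm] at h1
    change _ ∈ LinearMap.ker (g m) at h1
    rw [LinearMap.mem_ker, map_sub, hg, hg, sub_eq_zero] at h1
    exact h1
  · rintro _ ⟨x, hx, rfl⟩
    exact ⟨f^[m] x, ⟨x, hx, rfl⟩, (Function.iterate_succ_apply' ..).symm⟩

/-- Since `sInf ∅ = 0` in `ℕ`, `eta` has meaning only when its defining set is nonempty; finite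
generation ensures this. -/
theorem bijOn_of_eta_le {G : Type*} [AddCommGroup G] {f : G →+ G} {X : AddSubgroup G}
    (hX : X.FG) {m : ℕ} (h : eta f X ≤ m) : Set.BijOn f (f^[m] '' X) (f^[m + 1] '' X) :=
  Nat.sInf_mem (s := {k : ℕ | ∀ m, k ≤ m → Set.BijOn f (f^[m] '' X) (f^[m + 1] '' X)})
    (exists_bijOn_iterate_image f hX) m h

/-- Surjectivity onto the next iterated image is automatic, so only injectivity has to be checked.
-/
theorem eta_le {G : Type*} [AddCommGroup G] {f : G →+ G} {X : AddSubgroup G} {k : ℕ}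
    (h : ∀ m, k ≤ m → Set.InjOn f (f^[m] '' X)) : eta f X ≤ k := by
  refine Nat.sInf_le fun m hm => ⟨?_, h m hm, ?_⟩
  · rintro _ ⟨x, hx, rfl⟩
    exact ⟨x, hx, Function.iterate_succ_apply' ..⟩
  · rintro _ ⟨x, hx, rfl⟩
    exact ⟨f^[m] x, ⟨x, hx, rfl⟩, (Function.iterate_succ_apply' ..).symm⟩

end Eta

/-! ### Classes in `K_𝒫` and bounds on `Φ` and `Ψ`. -/

section Phi

variable {Λ : Type u} [Ring Λ]

/-- The class of `M` in `K_𝒫`. -/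
def clsP (M : FGModuleCat.{u} Λ) : KP Λ := QuotientAddGroup.mk' (gen (projectives Λ)) (cls M)

/-- The subgroup of `K_𝒫` generated by the classes of the indecomposables in `add X`. -/
def genP (X : FGModuleCat.{u} Λ) : AddSubgroup (KP Λ) :=
  (gen (add {X})).map (QuotientAddGroup.mk' (gen (projectives Λ)))

theorem finDim_mono {𝒳 𝒴 : Set (FGModuleCat.{u} Λ)} (h : 𝒳 ⊆ 𝒴) : finDim 𝒳 ≤ finDim 𝒴 :=
  sSup_le_sSup (Set.image_mono fun _ hX => ⟨h hX.1, hX.2⟩)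

variable [IsArtinianRing Λ]

theorem Lbar_clsP (M : FGModuleCat.{u} Λ) : Lbar (clsP M) = clsP (syzygy M) :=
  congrArg (QuotientAddGroup.mk' (gen (projectives Λ))) (L_cls M)

theorem Lbar_iterate_clsP (M : FGModuleCat.{u} Λ) (n : ℕ) :
    Lbar^[n] (clsP M) = clsP (syzygy^[n] M) := by
  induction n generalizing M with
  | zero => rfl
  | succ n ih => rw [Function.iterate_succ_apply, Lbar_clsP, ih, Function.iterate_succ_apply]

theorem clsP_eq_zero_of_projective (M : FGModuleCat.{u} Λ) [Module.Projective Λ M] :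
    clsP M = 0 :=
  (QuotientAddGroup.eq_zero_iff _).2 (cls_mem_gen M fun _ _ h => Or.inl h.projective)

theorem clsP_mem_genP (X : FGModuleCat.{u} Λ) : clsP X ∈ genP X :=
  ⟨cls X, cls_mem_gen X fun _ _ h => Or.inl (h.mem_add rfl), rfl⟩

theorem clsP_mem_genP_of_isSummand {Z X : FGModuleCat.{u} Λ} (h : IsSummand Z X) :
    clsP Z ∈ genP X :=
  ⟨cls Z, cls_mem_gen Z fun _ _ h' => Or.inl ((h'.trans h).mem_add rfl), rfl⟩

/-- The projective generators die in `K_𝒫`, and an indecomposable in `add X` is already a summand of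
`X`. -/
theorem genP_eq_closure (X : FGModuleCat.{u} Λ) :
    genP X = AddSubgroup.closure (clsP '' {Z | IsIndecomposable Z ∧ IsSummand Z X}) := by
  apply le_antisymm
  · rw [genP, AddSubgroup.map_le_iff_le_comap, gen, AddSubgroup.closure_le]
    rintro _ ⟨Z, ⟨hZ, h⟩, rfl⟩
    change clsP Z ∈ AddSubgroup.closure (clsP '' {Z | IsIndecomposable Z ∧ IsSummand Z X})
    rcases h with h | h
    · exact AddSubgroup.subset_closure ⟨Z, ⟨hZ, hZ.isSummand_of_mem_add h⟩, rfl⟩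
    · have : Module.Projective Λ Z := h
      rw [clsP_eq_zero_of_projective]
      exact zero_mem _
  · rw [AddSubgroup.closure_le]
    rintro _ ⟨Z, ⟨-, h⟩, rfl⟩
    exact clsP_mem_genP_of_isSummand h

theorem genP_fg (X : FGModuleCat.{u} Λ) : (genP X).FG := by
  rw [genP_eq_closure, AddSubgroup.fg_iff]
  refine ⟨_, rfl, ?_⟩
  have := (finite_cls_isSummand X).image (QuotientAddGroup.mk' (gen (projectives Λ)))
  rwa [Set.image_image] at this

/-- Syzygies commute with direct sums, so a summand `Z` of `X` gives a summand `ΩZ` of `ΩX`. -/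
theorem map_Lbar_genP_le (X : FGModuleCat.{u} Λ) : (genP X).map Lbar ≤ genP (syzygy X) := by
  rw [genP_eq_closure X, AddSubgroup.map_le_iff_le_comap, AddSubgroup.closure_le]
  rintro _ ⟨Z, ⟨-, N, ⟨e⟩⟩, rfl⟩
  change Lbar (clsP Z) ∈ genP (syzygy X)
  rw [Lbar_clsP]
  obtain ⟨e'⟩ := syzygy_prod e.symm
  exact clsP_mem_genP_of_isSummand (isSummand_fst e')

/-- The length of `Ω M`, as an additive function on `K`. -/
noncomputable def lengthSyzygy : K Λ →+ ℤ :=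
  (QuotientAddGroup.lift (relations Λ)
    (FreeAbelianGroup.lift (Quotient.lift
      (fun M : FGModuleCat.{u} Λ => ((Module.length Λ M).toNat : ℤ)) (fun M N h => by
        obtain ⟨i⟩ := (h : IsIsomorphic M N)
        rw [(FGModuleCat.isoToLinearEquiv i).length_eq]))) (by
    refine (AddSubgroup.closure_le _).2 ?_
    rintro _ ⟨M, X, Y, ⟨e⟩, rfl⟩
    change FreeAbelianGroup.lift _ _ = 0
    rw [map_sub, map_sub, FreeAbelianGroup.lift_apply_of, FreeAbelianGroup.lift_apply_of,
      FreeAbelianGroup.lift_apply_of]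
    change ((Module.length Λ M).toNat : ℤ) - (Module.length Λ X).toNat
      - (Module.length Λ Y).toNat = 0
    rw [e.length_eq, Module.length_prod,
      ENat.toNat_add Module.length_ne_top Module.length_ne_top]
    push_cast
    ring)).comp L

theorem lengthSyzygy_cls (M : FGModuleCat.{u} Λ) :
    lengthSyzygy (cls M) = (Module.length Λ (syzygy M)).toNat := by
  rw [lengthSyzygy, AddMonoidHom.comp_apply, L_cls]
  exact FreeAbelianGroup.lift_apply_of _ _

theorem gen_projectives_le_ker_lengthSyzygy :
    gen (projectives Λ) ≤ (lengthSyzygy (Λ := Λ)).ker := by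
  refine (AddSubgroup.closure_le _).2 ?_
  rintro _ ⟨P, ⟨-, hP⟩, rfl⟩
  have : Module.Projective Λ P := hP.elim id id
  have := subsingleton_syzygy P
  change lengthSyzygy (cls P) = 0
  rw [lengthSyzygy_cls, Module.length_eq_zero]
  rfl

/-- The length of `ΩM` is additive and zero on projectives, so it depends only on the class in
`K_𝒫`; if it is zero, then `ΩM = 0`. -/
theorem clsP_eq_zero_iff {M : FGModuleCat.{u} Λ} : clsP M = 0 ↔ Module.Projective Λ M := by
  refine ⟨fun h => ?_, fun h => clsP_eq_zero_of_projective M⟩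
  have h' : lengthSyzygy (cls M) = 0 :=
    gen_projectives_le_ker_lengthSyzygy ((QuotientAddGroup.eq_zero_iff _).1 h)
  -- `ENat.toNat` also sends `⊤` to `0`; finite length excludes that case.
  rw [lengthSyzygy_cls, Nat.cast_eq_zero, ENat.toNat_eq_zero] at h'
  exact projective_of_subsingleton_syzygy
    (Module.length_eq_zero_iff.1 (h'.resolve_right Module.length_ne_top))

theorem injOn_of_Phi_le {X : FGModuleCat.{u} Λ} {m : ℕ} (h : Phi X ≤ m) :
    Set.InjOn Lbar (Lbar^[m] '' (genP X : Set (KP Λ))) :=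
  (bijOn_of_eta_le (genP_fg X) h).injOn

/-- For modules of finite projective dimension, `pd X ≤ Φ(X)`. -/
theorem projDim_le_Phi {X : FGModuleCat.{u} Λ} (hX : projDim X < ⊤) : projDim X ≤ Phi X := by
  obtain ⟨k, hk⟩ := ENat.ne_top_iff_exists.1 hX.ne
  have hk' : Module.Projective Λ (syzygy^[Phi X + k] X) :=
    projDim_le_iff_projective.1 (by rw [← hk]; exact Nat.cast_le.2 (Nat.le_add_left _ _))
  rw [projDim_le_iff_projective]
  clear hk
  -- Descent from `Φ(X) + k` to `Φ(X)`: in this range `Lbar` is injective on the iterated images, so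
  -- a vanishing class of `Ω^(m+1) X` forces that of `Ω^m X` to vanish.
  induction k with
  | zero => exact hk'
  | succ k ih =>
    apply ih
    rw [← clsP_eq_zero_iff] at hk' ⊢
    rw [← Lbar_iterate_clsP] at hk' ⊢
    refine injOn_of_Phi_le (Nat.le_add_right (Phi X) k) ⟨clsP X, clsP_mem_genP X, rfl⟩
      ⟨0, zero_mem _, iterate_map_zero _ _⟩ ?_
    rw [map_zero]
    exact (Function.iterate_succ_apply' ..).symm.trans hk'

theorem PhiDim_le_PsiDim (𝒳 : Set (FGModuleCat.{u} Λ)) : PhiDim 𝒳 ≤ PsiDim 𝒳 := by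
  refine sSup_le ?_
  rintro _ ⟨X, hX, rfl⟩
  exact le_self_add.trans (le_sSup ⟨X, hX, rfl⟩)

/-- The image of `genP X` under `Lbar^(m+1)` lies in that of `genP (syzygy X)` under `Lbar^m`, where
`Lbar` is injective once `m ≥ Φ(ΩX)`. -/
theorem Phi_le_Phi_syzygy_add_one (X : FGModuleCat.{u} Λ) : Phi X ≤ Phi (syzygy X) + 1 := by
  refine eta_le fun m hm => ?_
  obtain ⟨m, rfl⟩ := Nat.exists_eq_add_of_le' (Nat.le_of_add_left_le hm)
  refine (injOn_of_Phi_le (X := syzygy X) (m := m) (by omega)).mono ?_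
  rintro _ ⟨x, hx, rfl⟩
  exact ⟨Lbar x, map_Lbar_genP_le X ⟨x, hx, rfl⟩, (Function.iterate_succ_apply ..).symm⟩

theorem Phi_eq_zero_of_PhiDim_eq_zero {𝒳 : Set (FGModuleCat.{u} Λ)} (h : PhiDim 𝒳 = 0)
    {X : FGModuleCat.{u} Λ} (hX : X ∈ 𝒳) : Phi X = 0 := by
  have : (Phi X : ℕ∞) ≤ PhiDim 𝒳 := le_sSup ⟨X, hX, rfl⟩
  rw [h] at this
  exact_mod_cast nonpos_iff_eq_zero.1 this

theorem finDim_le_PhiDim (𝒳 : Set (FGModuleCat.{u} Λ)) : finDim 𝒳 ≤ PhiDim 𝒳 := by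
  refine sSup_le ?_
  rintro _ ⟨X, ⟨hX, hX'⟩, rfl⟩
  exact (projDim_le_Phi hX').trans (le_sSup ⟨X, hX, rfl⟩)

theorem PhiDim_univ_le_one {T : FGModuleCat.{u} Λ} (hΦ : PhiDim (leftPerp T) = 0)
    (hid : injDim T ≤ 1) : PhiDim (Set.univ : Set (FGModuleCat.{u} Λ)) ≤ 1 := by
  refine sSup_le ?_
  rintro _ ⟨X, -, rfl⟩
  have h := Phi_le_Phi_syzygy_add_one X
  rw [Phi_eq_zero_of_PhiDim_eq_zero hΦ (syzygy_mem_leftPerp_of_injDim_le_one hid X)] at h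
  rw [zero_add] at h
  exact Nat.cast_le_one.2 h

theorem PsiDim_univ_le_one {T : FGModuleCat.{u} Λ} (hΦ : PhiDim (leftPerp T) = 0)
    (hid : injDim T ≤ 1) : PsiDim (Set.univ : Set (FGModuleCat.{u} Λ)) ≤ 1 := by
  refine sSup_le ?_
  rintro _ ⟨X, -, rfl⟩
  have hX : (Phi X : ℕ∞) ≤ 1 :=
    (le_sSup (Set.mem_image_of_mem _ (Set.mem_univ X))).trans (PhiDim_univ_le_one hΦ hid)
  have hX' : Phi X ≤ 1 := by exact_mod_cast hX
  rw [Psi]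
  rcases Nat.le_one_iff_eq_zero_or_eq_one.1 hX' with h | h
  · rw [h, Nat.cast_zero, zero_add]
    exact (finDim_mono (Set.subset_univ _)).trans
      ((finDim_le_PhiDim _).trans (PhiDim_univ_le_one hΦ hid))
  -- The class `⊥T` is closed under summands and contains `ΩX`, so `Φdim(⊥T) = 0` leaves no
  -- finitistic contribution.
  · have h0 : finDim {Z | IsSummand Z (syzygy^[1] X)} ≤ 0 := by
      refine ((finDim_mono ?_).trans (finDim_le_PhiDim (leftPerp T))).trans hΦ.le
      intro Z hZ
      rw [← add_leftPerp]
      exact hZ.mem_add (syzygy_mem_leftPerp_of_injDim_le_one hid X)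
    rw [h, Nat.cast_one]
    exact (add_le_add le_rfl h0).trans (add_zero _).le

end Phi

end LIT

theorem mainTheorem11 {Λ : Type u} [Ring Λ] [IsArtinAlgebra Λ] (T : FGModuleCat.{u} Λ)
    (hT : LIT.IsCotilting T) (hΦ : LIT.PhiDim (LIT.leftPerp T) = 0) (hid : LIT.injDim T ≤ 1) :
    (∀ n : ℕ, LIT.IsLITAlgebra Λ n (FGModuleCat.of Λ PUnit.{u + 1}) (LIT.leftPerp T)) ∧
      LIT.finDim (Set.univ : Set (FGModuleCat.{u} Λ)) ≤
        LIT.PhiDim (Set.univ : Set (FGModuleCat.{u} Λ)) ∧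
      LIT.PhiDim (Set.univ : Set (FGModuleCat.{u} Λ)) ≤
        LIT.PsiDim (Set.univ : Set (FGModuleCat.{u} Λ)) ∧
      LIT.PsiDim (Set.univ : Set (FGModuleCat.{u} Λ)) ≤ 1 :=
  ⟨LIT.isLITAlgebra_leftPerp hΦ hid, LIT.finDim_le_PhiDim _, LIT.PhiDim_le_PsiDim _,
    LIT.PsiDim_univ_le_one hΦ hid⟩
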